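/- Let $R$ be a regular local ring with maximal ideal $\mathfrak m$ and $\mathfrak m$-adic completion $\widehat R$, and let $x_1,\dots,x_n$ be a regular system of parameters of $R$ (that is, $n=\dim R$ and $\mathfrak m=(x_1,\dots,x_n)$). Every $f\in R$ can be written as a finite sum $f=\sum_{\alpha\in\mathbb Z_{\ge 0}^n}a_\alpha x_1^{\alpha_1}\cdots x_n^{\alpha_n}$ in which each $a_\alpha\in R$ is a unit or zero. For $f\neq 0$ the Newton polyhedron $\Delta(f)\subset\mathbb R_{\ge0}^n$ is the convex hull of $\{\alpha : a_\alpha\ne 0\}+\mathbb R_{\ge 0}^n$; it does not depend on the chosen expansion. A face of $\Delta=\Delta(f)$ is a set of the form $\Delta^\xi=\{p\in\Delta : \langle \xi,p\rangle=\min_{q\in\Delta}\langle\xi,q\rangle\}$ with $\xi\in\mathbb R_{\ge0}^n$; a vertex is a face of dimension $0$, and a loose edge is a compact face of dimension $1$ that is not contained in any compact face of dimension at least $2$. Corollary 1.3. Let $f\in R$ be nonzero. If $\Delta(f)$ has a loose edge and at least three vertices, then $f$ is not irreducible in $\widehat R$. -/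

import Mathlib

open scoped Pointwise

namespace NewtonPoly

/-- `x₁, …, xₙ` is a regular system of parameters of the local ring `R`: it generates the maximal
ideal and `n` is the Krull dimension of `R`. -/
def IsRegularSystemOfParameters {R : Type*} [CommRing R] [IsLocalRing R] {n : ℕ}
    (x : Fin n → R) : Prop :=
  Ideal.span (Set.range x) = IsLocalRing.maximalIdeal R ∧ ringKrullDim R = n

/-- `f = ∑ a_α x^α` is a finite expansion of `f` whose coefficients `a_α` are units or zero. -/
def IsExpansion {R : Type*} [CommRing R] {n : ℕ} (x : Fin n → R) (f : R)
    (a : (Fin n → ℕ) →₀ R) : Prop :=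
  (∀ α, IsUnit (a α) ∨ a α = 0) ∧ f = a.sum fun α c => c * ∏ i, x i ^ α i

/-- The Newton polyhedron of an expansion: the convex hull of `{α : a_α ≠ 0} + ℝ_{≥0}ⁿ`. -/
def polyhedron {R : Type*} [CommRing R] {n : ℕ} (a : (Fin n → ℕ) →₀ R) : Set (Fin n → ℝ) :=
  convexHull ℝ ({p | ∃ α, a α ≠ 0 ∧ p = fun i => (α i : ℝ)} + {z | 0 ≤ z})

/-- `Δ` is the Newton polyhedron `Δ(f)` of the nonzero element `f` with respect to the regular
system of parameters `x`. Every finite expansion of `f` with unit or zero coefficients may be used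
to compute it. -/
def IsNewtonPolyhedron {R : Type*} [CommRing R] {n : ℕ} (x : Fin n → R) (f : R)
    (Δ : Set (Fin n → ℝ)) : Prop :=
  f ≠ 0 ∧ ∃ a : (Fin n → ℕ) →₀ R, IsExpansion x f a ∧ Δ = polyhedron a

/-- `Δ^ξ`, the set of points of `Δ` at which `⟨ξ, ·⟩` attains its minimum over `Δ`. -/
def face {n : ℕ} (Δ : Set (Fin n → ℝ)) (ξ : Fin n → ℝ) : Set (Fin n → ℝ) :=
  {p | p ∈ Δ ∧ ∀ q ∈ Δ, ξ ⬝ᵥ p ≤ ξ ⬝ᵥ q}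

/-- The faces of `Δ` are the sets `Δ^ξ` with `ξ ∈ ℝ_{≥0}ⁿ`. -/
def IsFace {n : ℕ} (Δ F : Set (Fin n → ℝ)) : Prop :=
  ∃ ξ : Fin n → ℝ, 0 ≤ ξ ∧ F = face Δ ξ

/-- The (affine) dimension of a set. -/
noncomputable def dim {n : ℕ} (F : Set (Fin n → ℝ)) : ℕ :=
  Module.finrank ℝ (vectorSpan ℝ F)

/-- The vertices of `Δ`: the faces of dimension `0`, that is, the faces consisting of one point. -/
def vertices {n : ℕ} (Δ : Set (Fin n → ℝ)) : Set (Fin n → ℝ) :=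
  {p | IsFace Δ {p}}

/-- A loose edge: a compact face of dimension `1` that is not contained in any compact face of
dimension at least `2`. -/
def IsLooseEdge {n : ℕ} (Δ E : Set (Fin n → ℝ)) : Prop :=
  IsFace Δ E ∧ IsCompact E ∧ dim E = 1 ∧
    ¬ ∃ F, IsFace Δ F ∧ IsCompact F ∧ 2 ≤ dim F ∧ E ⊆ F

end NewtonPoly

/-!
The looseness of the edge `E = [a, b]` is used in the following form: with `d = b - a`, the whole
polyhedron lies in the cone `a + ℝ d + ℝ_{≥0}ⁿ`. Indeed, if a nonnegative covector orthogonal to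
`d` took a smaller value at some exponent than on `E`, tilting the covector of `E` towards it would
produce a compact face of dimension at least two containing `E` (`dotProduct_le_of_loose`); the
cone condition follows by duality (`exists_smul_le`).

Let `γ = a ⊓ b`, so that the part of `f` on the edge is `x^γ G`, where the exponents of `G` run from
`a - γ` to `b - γ` and both extreme coefficients are units. If `γ = 0`, the cone meets the orthant
only in `E + ℝ_{≥0}ⁿ`, and `a` and `b` are the only vertices
(`inf_ne_zero_of_three_vertices`). Hence three vertices force `γ ≠ 0`, and both `x^γ` and `G` lie in
the maximal ideal.

The factorization `x^γ G` of the edge part lifts to the completion by a Hensel argument. Filter by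
the weight of a positive covector `ξ` with face `E`, and only consider the ideals generated by the
monomials of a translate of the cone. Although `x^γ` and `G` need not be coprime, every monomial of
the cone at `a` is a combination of them, with coefficients in the appropriate translated cones
(`coneIdeal_le_division`): over the segment it is divisible by `x^γ`, and beyond an end of the
segment division by the leading monomial of `G` at that end moves it back. This improves an
approximate factorization of `f` by one step of the filtration at a time, inside `R`, and the
approximations converge in the completion (`exists_mul_eq_algebraMap_adicCompletion`). Monomial
ideals replace expansions of the error terms, so no coefficient field is needed.
-/

namespace NewtonPoly

/-! ### A Hensel lemma for filtered ideals -/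

/-- Let `P`, `Q`, `T` be filtrations with `P j * Q k ≤ T (j + k)`, finer than the `I`-adic one up to
the factor `K`, such that every element of `T k` is a combination of `G` and `H` with coefficients
in `Q k` and `P k`. If `f` agrees with `G * H` up to `T 1`, then the factorization lifts to the
`I`-adic completion, with factors congruent to `G` and `H` modulo `I`. All the approximations are
made in `R` itself. -/
theorem exists_mul_eq_algebraMap_adicCompletion {R : Type*} [CommRing R] {I : Ideal R}
    {P Q T : ℕ → Ideal R} {f G H : R} (K : ℕ)
    (hP : Antitone P) (hQ : Antitone Q) (hT : Antitone T)
    (hmul : ∀ j k, P j * Q k ≤ T (j + k))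
    (hdiv : ∀ k, ∀ δ ∈ T k, ∃ q ∈ Q k, ∃ r ∈ P k, δ = G * q + H * r)
    (hPI : ∀ N, P (K * N) ≤ I ^ N) (hQI : ∀ N, Q (K * N) ≤ I ^ N) (hTI : ∀ N, T (K * N) ≤ I ^ N)
    (hP1 : P 1 ≤ I) (hQ1 : Q 1 ≤ I) (hf : f - G * H ∈ T 1) :
    ∃ g h : AdicCompletion I R, algebraMap R (AdicCompletion I R) f = g * h ∧
      AdicCompletion.evalOneₐ I g = Ideal.Quotient.mk I G ∧
      AdicCompletion.evalOneₐ I h = Ideal.Quotient.mk I H := by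
  have step : ∀ (k : ℕ) (u : R × R), ∃ v : R × R,
      (u.1 - G ∈ P 1 ∧ u.2 - H ∈ Q 1 ∧ f - u.1 * u.2 ∈ T (k + 1)) →
      (v.1 - G ∈ P 1 ∧ v.2 - H ∈ Q 1 ∧ f - v.1 * v.2 ∈ T (k + 1 + 1)) ∧
      v.1 - u.1 ∈ P (k + 1) ∧ v.2 - u.2 ∈ Q (k + 1) := by
    rintro k ⟨g, h⟩
    by_cases hu : g - G ∈ P 1 ∧ h - H ∈ Q 1 ∧ f - g * h ∈ T (k + 1)
    · obtain ⟨h1, h2, h3⟩ := hu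
      obtain ⟨q, hq, r, hr, e⟩ := hdiv _ _ h3
      refine ⟨(g + r, h + q), fun _ => ⟨⟨?_, ?_, ?_⟩, by simpa using hr, by simpa using hq⟩⟩
      · have := add_mem h1 (hP (show 1 ≤ k + 1 by omega) hr)
        convert this using 1; ring
      · have := add_mem h2 (hQ (show 1 ≤ k + 1 by omega) hq)
        convert this using 1; ring
      · have e1 : (g - G) * q ∈ T (k + 1 + 1) :=
          hT (by omega) (hmul 1 (k + 1) (Ideal.mul_mem_mul h1 hq))
        have e2 : r * (h - H) ∈ T (k + 1 + 1) :=
          hT (by omega) (hmul (k + 1) 1 (Ideal.mul_mem_mul hr h2))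
        have e3 : r * q ∈ T (k + 1 + 1) :=
          hT (by omega) (hmul (k + 1) (k + 1) (Ideal.mul_mem_mul hr hq))
        have := neg_mem (add_mem (add_mem e1 e2) e3)
        convert this using 1
        linear_combination e
    · exact ⟨0, fun h => absurd h hu⟩
  choose next hnext using step
  let u : ℕ → R × R := fun k => Nat.rec (G, H) next k
  have hu : ∀ k, (u k).1 - G ∈ P 1 ∧ (u k).2 - H ∈ Q 1 ∧ f - (u k).1 * (u k).2 ∈ T (k + 1) := by
    intro k
    induction k with
    | zero => exact ⟨by simp [u], by simp [u], hf⟩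
    | succ k ih => exact (hnext k (u k) ih).1
  have hPc : ∀ k j, (u (k + j)).1 - (u k).1 ∈ P k := by
    intro k j
    induction j with
    | zero => simp
    | succ j ih =>
      have := add_mem (hP (show k ≤ k + j + 1 by omega) (hnext (k + j) _ (hu _)).2.1) ih
      convert this using 1
      simp [u, ← add_assoc]
  have hQc : ∀ k j, (u (k + j)).2 - (u k).2 ∈ Q k := by
    intro k j
    induction j with
    | zero => simp
    | succ j ih =>
      have := add_mem (hQ (show k ≤ k + j + 1 by omega) (hnext (k + j) _ (hu _)).2.2) ih
      convert this using 1
      simp [u, ← add_assoc]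
  let g : AdicCompletion.AdicCauchySequence I R :=
    .mk I R (fun N => (u (K * N)).1) (fun N => by
      rw [SModEq.comm, SModEq.sub_mem, smul_eq_mul, Ideal.mul_top]
      exact hPI N (hPc _ _))
  let h : AdicCompletion.AdicCauchySequence I R :=
    .mk I R (fun N => (u (K * N)).2) (fun N => by
      rw [SModEq.comm, SModEq.sub_mem, smul_eq_mul, Ideal.mul_top]
      exact hQI N (hQc _ _))
  refine ⟨AdicCompletion.mk I R g, AdicCompletion.mk I R h, ?_, ?_, ?_⟩
  · apply AdicCompletion.ext_evalₐ
    intro N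
    rw [map_mul, AdicCompletion.evalₐ_mk, AdicCompletion.evalₐ_mk, AlgHom.commutes, ← map_mul,
      Ideal.Quotient.algebraMap_eq, Ideal.Quotient.eq]
    exact hTI N (hT (by omega) (hu (K * N)).2.2)
  · change Ideal.Quotient.mk I (g 1) = _
    rw [Ideal.Quotient.eq]
    exact hP1 (hu _).1
  · change Ideal.Quotient.mk I (h 1) = _
    rw [Ideal.Quotient.eq]
    exact hQ1 (hu _).2.1

/-! ### Monomials and the ideals of a cone -/

/-- The monomial `x^α`. -/
def monomial {R : Type*} [CommRing R] {n : ℕ} (x : Fin n → R) (α : Fin n → ℕ) : R :=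
  ∏ i, x i ^ α i

/-- The exponent `α` as a point of `ℝⁿ`. -/
def toReal {n : ℕ} (α : Fin n → ℕ) : Fin n → ℝ := fun i => (α i : ℝ)

theorem monomial_add {R : Type*} [CommRing R] {n : ℕ} (x : Fin n → R) (α β : Fin n → ℕ) :
    monomial x (α + β) = monomial x α * monomial x β := by
  simp [monomial, pow_add, Finset.prod_mul_distrib]

theorem toReal_add {n : ℕ} (α β : Fin n → ℕ) : toReal (α + β) = toReal α + toReal β := by
  ext i; simp [toReal]

theorem toReal_sub {n : ℕ} {α β : Fin n → ℕ} (h : β ≤ α) :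
    toReal (α - β) = toReal α - toReal β := by
  ext i; simp [toReal, Nat.cast_sub (h i)]

theorem toReal_injective {n : ℕ} : Function.Injective (toReal (n := n)) := by
  intro α β h
  ext i
  exact Nat.cast_injective (R := ℝ) (congrFun h i)

theorem monomial_mem_pow_sum {R : Type*} [CommRing R] {n : ℕ} {x : Fin n → R} {I : Ideal R}
    (hx : ∀ i, x i ∈ I) (α : Fin n → ℕ) : monomial x α ∈ I ^ (∑ i, α i) := by
  rw [← Finset.prod_pow_eq_pow_sum]
  exact Ideal.prod_mem_prod fun i _ => Ideal.pow_mem_pow (hx i) _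

/-- The exponents of the cone `p + ℝ d + ℝ_{≥0}ⁿ` whose weight `⟨ξ, ·⟩` exceeds that of `p` by at
least `w`. -/
def coneExponents {n : ℕ} (ξ d p : Fin n → ℝ) (w : ℝ) : Set (Fin n → ℕ) :=
  {α | ξ ⬝ᵥ p + w ≤ ξ ⬝ᵥ toReal α ∧ ∃ t : ℝ, p + t • d ≤ toReal α}

/-- The ideal generated by the monomials with exponent in `coneExponents ξ d p w`. -/
def coneIdeal {R : Type*} [CommRing R] {n : ℕ} (x : Fin n → R) (ξ d p : Fin n → ℝ) (w : ℝ) :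
    Ideal R :=
  Ideal.span (monomial x '' coneExponents ξ d p w)

section coneIdeal

variable {R : Type*} [CommRing R] {n : ℕ} {x : Fin n → R} {ξ d p q : Fin n → ℝ} {w w' : ℝ}

theorem monomial_mem_coneIdeal {α : Fin n → ℕ} (h : α ∈ coneExponents ξ d p w) :
    monomial x α ∈ coneIdeal x ξ d p w :=
  Ideal.subset_span ⟨α, h, rfl⟩

theorem coneIdeal_le {J : Ideal R} (h : ∀ α ∈ coneExponents ξ d p w, monomial x α ∈ J) :
    coneIdeal x ξ d p w ≤ J := by
  rw [coneIdeal, Ideal.span_le]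
  rintro _ ⟨α, hα, rfl⟩
  exact h α hα

theorem coneIdeal_anti (h : w ≤ w') : coneIdeal x ξ d p w' ≤ coneIdeal x ξ d p w :=
  coneIdeal_le fun _ hα => monomial_mem_coneIdeal ⟨by linarith [hα.1], hα.2⟩

theorem coneIdeal_mul_le :
    coneIdeal x ξ d p w * coneIdeal x ξ d q w' ≤ coneIdeal x ξ d (p + q) (w + w') := by
  rw [coneIdeal, coneIdeal, Ideal.span_mul_span', Ideal.span_le]
  rintro _ ⟨_, ⟨α, ⟨hα, s, hs⟩, rfl⟩, _, ⟨β, ⟨hβ, t, ht⟩, rfl⟩, rfl⟩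
  change monomial x α * monomial x β ∈ _
  rw [← monomial_add]
  refine monomial_mem_coneIdeal ⟨?_, s + t, ?_⟩
  · rw [toReal_add, dotProduct_add, dotProduct_add]
    linarith
  · rw [toReal_add]
    refine le_of_eq_of_le ?_ (add_le_add hs ht)
    module

/-- Moving the base point along the line, and reversing the direction of the line, do not change
the ideal. -/
theorem coneIdeal_reverse (hd : ξ ⬝ᵥ d = 0) :
    coneIdeal x ξ (-d) (p + d) w = coneIdeal x ξ d p w := by
  have : coneExponents ξ (-d) (p + d) w = coneExponents ξ d p w := by
    ext α
    constructor
    · rintro ⟨h, t, ht⟩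
      refine ⟨by simpa [dotProduct_add, hd] using h, 1 - t, ?_⟩
      convert ht using 1
      module
    · rintro ⟨h, t, ht⟩
      refine ⟨by simpa [dotProduct_add, hd] using h, 1 - t, ?_⟩
      convert ht using 1
      module
  rw [coneIdeal, coneIdeal, this]

/-- A positive weight of at least `M * N`, with `M` bounding the weights of the variables, forces
degree at least `N`. -/
theorem coneIdeal_le_pow {I : Ideal R} (hx : ∀ i, x i ∈ I) {M : ℝ} (hM : 0 < M)
    (hξM : ∀ i, ξ i ≤ M) (hp : 0 ≤ ξ ⬝ᵥ p) {N : ℕ} (h : M * N ≤ w) :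
    coneIdeal x ξ d p w ≤ I ^ N := by
  refine coneIdeal_le fun α hα => Ideal.pow_le_pow_right ?_ (monomial_mem_pow_sum hx α)
  have h1 : ξ ⬝ᵥ toReal α ≤ M * (∑ i, α i : ℕ) := by
    rw [Nat.cast_sum, Finset.mul_sum]
    exact Finset.sum_le_sum fun i _ => mul_le_mul_of_nonneg_right (hξM i) (Nat.cast_nonneg _)
  have h2 : M * N ≤ M * (∑ i, α i : ℕ) := by linarith [hα.1]
  exact_mod_cast le_of_mul_le_mul_left h2 hM

theorem coneIdeal_le_of_pos {I : Ideal R} (hx : ∀ i, x i ∈ I) (hp : 0 ≤ ξ ⬝ᵥ p) (hw : 0 < w) :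
    coneIdeal x ξ d p w ≤ I := by
  refine coneIdeal_le fun α hα => ?_
  have hne : ∑ i, α i ≠ 0 := by
    intro h0
    have : toReal α = 0 := by
      ext i
      simpa [toReal] using (Finset.sum_eq_zero_iff.mp h0) i (Finset.mem_univ i)
    have h1 := hα.1
    rw [this, dotProduct_zero] at h1
    linarith
  exact Ideal.pow_le_self hne (monomial_mem_pow_sum hx α)

end coneIdeal

/-! ### Division by the edge polynomial -/

section division

variable {R : Type*} [CommRing R] {n : ℕ}

/-- The part of `∑ c_s x^s` with exponents in `S`, divided by the monomial `x^γ`. -/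
def edgePoly (x : Fin n → R) (S : Finset (Fin n → ℕ)) (c : (Fin n → ℕ) → R) (γ : Fin n → ℕ) : R :=
  ∑ s ∈ S, c s * monomial x (s - γ)

/-- The monomials beyond the end `a` of the edge, in the direction of `b`. A monomial over the
segment is divisible by `x^γ`; one beyond `b` is divisible by the leading monomial `x^(b - γ)` of
the edge polynomial, and a division step moves it back towards the segment. -/
theorem monomial_mem_division_of_nonneg (x : Fin n → R) {ξ : Fin n → ℝ}
    {S : Finset (Fin n → ℕ)} {c : (Fin n → ℕ) → R} {a b : Fin n → ℕ}
    (hb : b ∈ S) (hcb : IsUnit (c b)) (hξ : ξ ⬝ᵥ (toReal b - toReal a) = 0)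
    (hS : ∀ s ∈ S, ∃ t : ℝ, 0 ≤ t ∧ t ≤ 1 ∧ toReal s = toReal a + t • (toReal b - toReal a))
    {i₀ : Fin n} (hi₀ : a i₀ < b i₀) {w t : ℝ} (ht : 0 ≤ t) {α : Fin n → ℕ}
    (hw : ξ ⬝ᵥ toReal a + w ≤ ξ ⬝ᵥ toReal α)
    (hα : toReal a + t • (toReal b - toReal a) ≤ toReal α) :
    monomial x α ∈
      Ideal.span {edgePoly x S c (a ⊓ b)} *
          coneIdeal x ξ (toReal b - toReal a) (toReal (a ⊓ b)) w ⊔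
        Ideal.span {monomial x (a ⊓ b)} *
          coneIdeal x ξ (toReal b - toReal a) (toReal a - toReal (a ⊓ b)) w := by
  classical
  set d := toReal b - toReal a with hd
  set γ := a ⊓ b with hγ
  set J := Ideal.span {edgePoly x S c γ} * coneIdeal x ξ d (toReal γ) w ⊔
        Ideal.span {monomial x γ} * coneIdeal x ξ d (toReal a - toReal γ) w with hJ
  have hγb : γ ≤ b := inf_le_right
  -- A point of the segment dominates `γ`.
  have hseg : ∀ (β : Fin n → ℕ) (s : ℝ), 0 ≤ s → s ≤ 1 → toReal a + s • d ≤ toReal β → γ ≤ β := by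
    intro β s hs0 hs1 h i
    have h1 := h i
    have h2 : (γ i : ℝ) ≤ a i := by exact_mod_cast (inf_le_left : γ ≤ a) i
    have h3 : (γ i : ℝ) ≤ b i := by exact_mod_cast hγb i
    simp only [hd, toReal, Pi.add_apply, Pi.smul_apply, Pi.sub_apply, smul_eq_mul] at h1
    have : (γ i : ℝ) ≤ β i := by nlinarith
    exact_mod_cast this
  obtain ⟨N, hN⟩ : ∃ N, α i₀ = N := ⟨_, rfl⟩
  induction N using Nat.strong_induction_on generalizing t α with
  | _ N ih =>
  by_cases ht1 : t ≤ 1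
  · have hγα : γ ≤ α := hseg α t ht ht1 hα
    have : monomial x α = monomial x γ * monomial x (α - γ) := by
      rw [← monomial_add, add_tsub_cancel_of_le hγα]
    rw [this]
    refine (le_sup_right : _ ≤ J) (Ideal.mul_mem_mul (Ideal.mem_span_singleton_self _)
      (monomial_mem_coneIdeal ⟨?_, t, ?_⟩))
    · rw [toReal_sub hγα, dotProduct_sub, dotProduct_sub]
      linarith
    · rw [toReal_sub hγα]
      convert sub_le_sub_right hα (toReal γ) using 1
      abel
  · push Not at ht1
    have hbα : b - γ ≤ α := by
      intro i
      have h1 := hα i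
      simp only [hd, toReal, Pi.add_apply, Pi.smul_apply, Pi.sub_apply, smul_eq_mul] at h1
      rcases le_total (b i) (a i) with h | h
      · simp [hγ, h]
      · have h' : (a i : ℝ) ≤ b i := by exact_mod_cast h
        have : (b i : ℝ) ≤ α i := by nlinarith
        have : b i ≤ α i := by exact_mod_cast this
        simp only [Pi.sub_apply]
        omega
    set β := α - (b - γ) with hβ
    have hβr : toReal β = toReal α - toReal b + toReal γ := by
      rw [hβ, toReal_sub hbα, toReal_sub hγb]
      abel
    have hβα : β + (b - γ) = α := tsub_add_cancel_of_le hbα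
    have hβmem : monomial x β ∈ coneIdeal x ξ d (toReal γ) w := by
      refine monomial_mem_coneIdeal ⟨?_, t - 1, ?_⟩
      · rw [hβr, dotProduct_add, dotProduct_sub]
        rw [dotProduct_sub] at hξ
        linarith
      · rw [hβr]
        have := add_le_add_left (sub_le_sub_right hα (toReal b)) (toReal γ)
        convert this using 1
        rw [hd]
        module
    have hrest : ∀ s ∈ S.erase b, monomial x β * monomial x (s - γ) ∈ J := by
      intro s hs
      obtain ⟨hsb, hsS⟩ := Finset.mem_erase.mp hs
      obtain ⟨τ, hτ0, hτ1, hsτ⟩ := hS s hsS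
      have hτ : τ < 1 := by
        refine lt_of_le_of_ne hτ1 fun h => hsb (toReal_injective ?_)
        rw [hsτ, h, hd]
        module
      have hγs : γ ≤ s := hseg s τ hτ0 hτ1 hsτ.ge
      have hr : toReal (β + (s - γ)) = toReal α - (1 - τ) • d := by
        rw [toReal_add, toReal_sub hγs, hβr, hsτ, hd]
        module
      rw [← monomial_add]
      have hd0 : (0 : ℝ) < d i₀ := by
        simp only [hd, toReal, Pi.sub_apply, sub_pos]
        exact_mod_cast hi₀
      refine ih ((β + (s - γ)) i₀) ?_ (t := t - (1 - τ)) (by linarith) ?_ ?_ rfl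
      · have h1 := congrFun hr i₀
        simp only [toReal, Pi.sub_apply, Pi.smul_apply, smul_eq_mul] at h1
        have h2 : ((β + (s - γ)) i₀ : ℝ) < α i₀ := by
          rw [h1]
          nlinarith
        rw [← hN]
        exact_mod_cast h2
      · rw [hr, dotProduct_sub, dotProduct_smul, hξ]
        simpa using hw
      · rw [hr]
        convert sub_le_sub_right hα ((1 - τ) • d) using 1
        module
    have hkey : c b * monomial x α = edgePoly x S c γ * monomial x β -
        ∑ s ∈ S.erase b, c s * (monomial x β * monomial x (s - γ)) := by
      rw [edgePoly, ← Finset.add_sum_erase _ _ hb, ← hβα, monomial_add, add_mul, Finset.sum_mul]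
      rw [show ∑ s ∈ S.erase b, c s * monomial x (s - γ) * monomial x β =
        ∑ s ∈ S.erase b, c s * (monomial x β * monomial x (s - γ)) from
          Finset.sum_congr rfl fun s _ => by ring]
      ring
    rw [← Ideal.unit_mul_mem_iff_mem J hcb, hkey]
    refine sub_mem ?_ (sum_mem fun s hs => Ideal.mul_mem_left _ _ (hrest s hs))
    exact (le_sup_left : _ ≤ J) (Ideal.mul_mem_mul (Ideal.mem_span_singleton_self _) hβmem)

/-- The edge polynomial and `x^γ` are coprime in the sense needed for lifting: their combinations,
with coefficients in the appropriate cone ideals, fill the cone ideal of the edge. -/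
theorem coneIdeal_le_division (x : Fin n → R) {ξ : Fin n → ℝ}
    {S : Finset (Fin n → ℕ)} {c : (Fin n → ℕ) → R} {a b : Fin n → ℕ}
    (ha : a ∈ S) (hb : b ∈ S) (hca : IsUnit (c a)) (hcb : IsUnit (c b))
    (hξ : ξ ⬝ᵥ (toReal b - toReal a) = 0)
    (hS : ∀ s ∈ S, ∃ t : ℝ, 0 ≤ t ∧ t ≤ 1 ∧ toReal s = toReal a + t • (toReal b - toReal a))
    (hab : ∃ i, a i < b i) (hba : ∃ i, b i < a i) (w : ℝ) :
    coneIdeal x ξ (toReal b - toReal a) (toReal a) w ≤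
      Ideal.span {edgePoly x S c (a ⊓ b)} *
          coneIdeal x ξ (toReal b - toReal a) (toReal (a ⊓ b)) w ⊔
        Ideal.span {monomial x (a ⊓ b)} *
          coneIdeal x ξ (toReal b - toReal a) (toReal a - toReal (a ⊓ b)) w := by
  obtain ⟨i, hi⟩ := hab
  obtain ⟨j, hj⟩ := hba
  rintro y hy
  refine coneIdeal_le (fun α hα => ?_) hy
  obtain ⟨hw, t, ht⟩ := hα
  rcases le_total 0 t with h0 | h0
  · exact monomial_mem_division_of_nonneg x hb hcb hξ hS hi h0 hw ht
  · have hξ' : ξ ⬝ᵥ (toReal a - toReal b) = 0 := by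
      rw [← neg_sub, dotProduct_neg, hξ, neg_zero]
    have hS' : ∀ s ∈ S, ∃ t : ℝ, 0 ≤ t ∧ t ≤ 1 ∧
        toReal s = toReal b + t • (toReal a - toReal b) := by
      intro s hs
      obtain ⟨t, h0, h1, h⟩ := hS s hs
      refine ⟨1 - t, by linarith, by linarith, ?_⟩
      rw [h]
      module
    have h := monomial_mem_division_of_nonneg x ha hca hξ' hS' hj (w := w) (t := 1 - t)
      (by linarith) (α := α) (by rw [dotProduct_sub] at hξ; linarith) (by
        convert ht using 1
        module)
    rw [inf_comm b a] at h
    have e1 : coneIdeal x ξ (toReal a - toReal b) (toReal b - toReal (a ⊓ b)) w =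
        coneIdeal x ξ (toReal b - toReal a) (toReal a - toReal (a ⊓ b)) w := by
      rw [← coneIdeal_reverse hξ]
      congr 1 <;> abel
    have e2 : coneIdeal x ξ (toReal a - toReal b) (toReal (a ⊓ b)) w ≤
        coneIdeal x ξ (toReal b - toReal a) (toReal (a ⊓ b)) w := by
      refine coneIdeal_le fun α hα => monomial_mem_coneIdeal ⟨hα.1, ?_⟩
      obtain ⟨-, t, ht⟩ := hα
      refine ⟨-t, ?_⟩
      convert ht using 1
      module
    rw [e1] at h
    exact sup_le_sup_right (Ideal.mul_mono_right e2) _ h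

end division

/-! ### Lifting the factorization of the edge polynomial -/

section factorization

variable {R : Type*} [CommRing R] {n : ℕ}

theorem dotProduct_toReal_lt {ξ : Fin n → ℝ} (hξ : ∀ i, 0 < ξ i) {α β : Fin n → ℕ} (h : α ≤ β)
    {i : Fin n} (hi : α i < β i) : ξ ⬝ᵥ toReal α < ξ ⬝ᵥ toReal β :=
  Finset.sum_lt_sum
    (fun j _ => mul_le_mul_of_nonneg_left (by simpa [toReal] using h j) (hξ j).le)
    ⟨i, Finset.mem_univ i, mul_lt_mul_of_pos_left (by simpa [toReal] using hi) (hξ i)⟩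

theorem exists_lt_of_dotProduct_eq {ξ : Fin n → ℝ} (hξ : ∀ i, 0 < ξ i) {a b : Fin n → ℕ}
    (hab : a ≠ b) (h : ξ ⬝ᵥ (toReal b - toReal a) = 0) : ∃ i, a i < b i := by
  by_contra! hle
  obtain ⟨i, hi⟩ := Function.ne_iff.mp hab
  have := dotProduct_toReal_lt hξ (Pi.le_def.mpr hle) (lt_of_le_of_ne (hle i) (Ne.symm hi))
  rw [dotProduct_sub] at h
  linarith

/-- The arithmetic half of the argument. If all exponents of `f` lie in the cone
`a + ℝ (b - a) + ℝ_{≥0}ⁿ`, those of minimal weight lie on the segment `[a, b]`, and the common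
monomial factor `x^(a ⊓ b)` of the edge is nontrivial, then splitting that monomial off the edge
polynomial lifts to a factorization of `f` in the completion. -/
theorem not_irreducible_of_exponents_mem_cone {I : Ideal R} (hI : I ≠ ⊤) {x : Fin n → R}
    (hx : ∀ i, x i ∈ I) {F : Finset (Fin n → ℕ)} {c : (Fin n → ℕ) → R} {a b : Fin n → ℕ}
    (ha : a ∈ F) (hb : b ∈ F) (hca : IsUnit (c a)) (hcb : IsUnit (c b)) (hab : a ≠ b)
    {ξ : Fin n → ℝ} (hξ : ∀ i, 0 < ξ i) (hξd : ξ ⬝ᵥ (toReal b - toReal a) = 0)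
    (hcone : ∀ s ∈ F, ∃ t : ℝ, toReal a + t • (toReal b - toReal a) ≤ toReal s)
    (hedge : ∀ s ∈ F, ξ ⬝ᵥ toReal s = ξ ⬝ᵥ toReal a →
      ∃ t : ℝ, 0 ≤ t ∧ t ≤ 1 ∧ toReal s = toReal a + t • (toReal b - toReal a))
    (hγ : a ⊓ b ≠ 0) :
    ¬ Irreducible (algebraMap R (AdicCompletion I R) (∑ s ∈ F, c s * monomial x s)) := by
  classical
  set d := toReal b - toReal a with hd
  set γ := a ⊓ b with hγdef
  set S := F.filter fun s => ξ ⬝ᵥ toReal s = ξ ⬝ᵥ toReal a with hSdef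
  have hξab : ξ ⬝ᵥ toReal b = ξ ⬝ᵥ toReal a := by
    rw [hd, dotProduct_sub] at hξd
    linarith
  have haS : a ∈ S := Finset.mem_filter.mpr ⟨ha, rfl⟩
  have hbS : b ∈ S := Finset.mem_filter.mpr ⟨hb, hξab⟩
  have hlt : ∃ i, a i < b i := exists_lt_of_dotProduct_eq hξ hab hξd
  have hgt : ∃ i, b i < a i := exists_lt_of_dotProduct_eq hξ hab.symm (by
    rw [dotProduct_sub, hξab, sub_self])
  have hmono : ∀ {u v : Fin n → ℝ}, u ≤ v → ξ ⬝ᵥ u ≤ ξ ⬝ᵥ v := fun h =>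
    dotProduct_le_dotProduct_of_nonneg_left h fun i => (hξ i).le
  have hweight : ∀ s ∈ F, ξ ⬝ᵥ toReal a ≤ ξ ⬝ᵥ toReal s := by
    intro s hs
    obtain ⟨t, ht⟩ := hcone s hs
    have := hmono ht
    rwa [dotProduct_add, dotProduct_smul, hξd, smul_zero, add_zero] at this
  -- `f` has finitely many terms, so those off the edge exceed its weight by a fixed `ε`.
  obtain ⟨ε, hε, hεF⟩ : ∃ ε : ℝ, 0 < ε ∧
      ∀ s ∈ F.filter (fun s => ¬ ξ ⬝ᵥ toReal s = ξ ⬝ᵥ toReal a),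
        ξ ⬝ᵥ toReal a + ε ≤ ξ ⬝ᵥ toReal s := by
    rcases (F.filter (fun s => ¬ ξ ⬝ᵥ toReal s = ξ ⬝ᵥ toReal a)).eq_empty_or_nonempty with h | h
    · exact ⟨1, one_pos, by simp [h]⟩
    · obtain ⟨s₀, hs₀, hmin⟩ := Finset.exists_min_image _ (fun s => ξ ⬝ᵥ toReal s) h
      obtain ⟨h1, h2⟩ := Finset.mem_filter.mp hs₀
      refine ⟨ξ ⬝ᵥ toReal s₀ - ξ ⬝ᵥ toReal a, sub_pos.mpr (lt_of_le_of_ne (hweight s₀ h1)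
        (Ne.symm h2)), fun s hs => ?_⟩
      linarith [hmin s hs]
  have hγa : toReal γ ≤ toReal a := fun i =>
    Nat.cast_le.mpr ((inf_le_left : γ ≤ a) i)
  have hnn : ∀ s : Fin n → ℕ, 0 ≤ toReal s := fun s i => Nat.cast_nonneg _
  have hp1 : 0 ≤ ξ ⬝ᵥ (toReal a - toReal γ) := by
    simpa using hmono (sub_nonneg.mpr hγa)
  have hp2 : ∀ s, 0 ≤ ξ ⬝ᵥ toReal s := fun s => by simpa using hmono (hnn s)
  set M : ℝ := ∑ i, ξ i + 1 with hM
  have hMpos : 0 < M := add_pos_of_nonneg_of_pos (Finset.sum_nonneg fun i _ => (hξ i).le) one_pos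
  have hξM : ∀ i, ξ i ≤ M := fun i => by
    have := Finset.single_le_sum (f := ξ) (fun i _ => (hξ i).le) (Finset.mem_univ i)
    linarith
  obtain ⟨K, hK⟩ := exists_nat_ge (M / ε)
  have hKN : ∀ N : ℕ, M * N ≤ ((K * N : ℕ) : ℝ) * ε := fun N => by
    rw [div_le_iff₀ hε] at hK
    push_cast
    nlinarith [mul_le_mul_of_nonneg_right hK (Nat.cast_nonneg (α := ℝ) N)]
  have hanti : ∀ p, Antitone fun k : ℕ => coneIdeal x ξ d p (k * ε) := fun p j k hjk =>
    coneIdeal_anti (mul_le_mul_of_nonneg_right (by exact_mod_cast hjk) hε.le)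
  obtain ⟨g, h, hgh, hg, hh⟩ := exists_mul_eq_algebraMap_adicCompletion (I := I)
    (P := fun k => coneIdeal x ξ d (toReal a - toReal γ) (k * ε))
    (Q := fun k => coneIdeal x ξ d (toReal γ) (k * ε))
    (T := fun k => coneIdeal x ξ d (toReal a) (k * ε))
    (f := ∑ s ∈ F, c s * monomial x s) (G := edgePoly x S c γ) (H := monomial x γ) K
    (hanti _) (hanti _) (hanti _)
    (fun j k => by
      refine coneIdeal_mul_le.trans (le_of_eq ?_)
      congr 1
      · abel
      · push_cast; ring)
    (fun k δ hδ => by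
      have := coneIdeal_le_division x haS hbS hca hcb hξd
        (fun s hs => hedge s (Finset.mem_filter.mp hs).1 (Finset.mem_filter.mp hs).2) hlt hgt _ hδ
      obtain ⟨y, hy, z, hz, rfl⟩ := Submodule.mem_sup.mp this
      obtain ⟨q, hq, rfl⟩ := Ideal.mem_span_singleton_mul.mp hy
      obtain ⟨r, hr, rfl⟩ := Ideal.mem_span_singleton_mul.mp hz
      exact ⟨q, hq, r, hr, rfl⟩)
    (fun N => coneIdeal_le_pow hx hMpos hξM hp1 (hKN N))
    (fun N => coneIdeal_le_pow hx hMpos hξM (hp2 _) (hKN N))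
    (fun N => coneIdeal_le_pow hx hMpos hξM (hp2 _) (hKN N))
    (coneIdeal_le_of_pos hx hp1 (by simpa using hε))
    (coneIdeal_le_of_pos hx (hp2 _) (by simpa using hε))
    (by
      have hE : edgePoly x S c γ * monomial x γ = ∑ s ∈ S, c s * monomial x s := by
        rw [edgePoly, Finset.sum_mul]
        refine Finset.sum_congr rfl fun s hs => ?_
        obtain ⟨hsF, hsw⟩ := Finset.mem_filter.mp hs
        obtain ⟨t, h0, h1, hst⟩ := hedge s hsF hsw
        have hγs : γ ≤ s := by
          intro i
          have h2 := congrFun hst i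
          have h3 : (γ i : ℝ) ≤ b i := by exact_mod_cast (inf_le_right : γ ≤ b) i
          have h4 : (γ i : ℝ) ≤ a i := hγa i
          simp only [hd, toReal, Pi.add_apply, Pi.smul_apply, Pi.sub_apply, smul_eq_mul] at h2
          have : (γ i : ℝ) ≤ s i := by nlinarith
          exact_mod_cast this
        rw [mul_assoc, ← monomial_add, tsub_add_cancel_of_le hγs]
      rw [hE, ← Finset.sum_filter_add_sum_filter_not F
        (fun s => ξ ⬝ᵥ toReal s = ξ ⬝ᵥ toReal a), add_sub_cancel_left]
      refine sum_mem fun s hs => Ideal.mul_mem_left _ _ (monomial_mem_coneIdeal ⟨?_, ?_⟩)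
      · simpa using hεF s hs
      · exact hcone s (Finset.mem_filter.mp hs).1)
  have hmemI : ∀ s : Fin n → ℕ, s ≠ 0 → monomial x s ∈ I := fun s hs => by
    refine Ideal.pow_le_self (fun h0 => hs ?_) (monomial_mem_pow_sum hx s)
    ext i
    exact (Finset.sum_eq_zero_iff.mp h0) i (Finset.mem_univ i)
  have hHI : monomial x γ ∈ I := hmemI γ hγ
  have hGI : edgePoly x S c γ ∈ I := by
    refine sum_mem fun s hs => Ideal.mul_mem_left _ _ (hmemI _ fun h0 => ?_)
    obtain ⟨i, hi⟩ := hgt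
    have h1 : ξ ⬝ᵥ toReal γ < ξ ⬝ᵥ toReal a :=
      dotProduct_toReal_lt hξ inf_le_left (i := i) (by simp [hγdef, hi])
    have h2 : ξ ⬝ᵥ toReal s ≤ ξ ⬝ᵥ toReal γ := hmono fun i => by
      have := tsub_eq_zero_iff_le.mp h0 i
      simpa [toReal] using this
    linarith [(Finset.mem_filter.mp hs).2]
  have : Nontrivial (R ⧸ I) := Ideal.Quotient.nontrivial_iff.mpr hI
  intro hirr
  rcases hirr.isUnit_or_isUnit hgh with hu | hu
  · have := hu.map (AdicCompletion.evalOneₐ I)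
    rw [hg, Ideal.Quotient.eq_zero_iff_mem.mpr hGI] at this
    exact not_isUnit_zero this
  · have := hu.map (AdicCompletion.evalOneₐ I)
    rw [hh, Ideal.Quotient.eq_zero_iff_mem.mpr hHI] at this
    exact not_isUnit_zero this

end factorization

/-! ### Faces of the Newton polyhedron -/

section geometry

variable {R : Type*} [CommRing R] {n : ℕ} {c : (Fin n → ℕ) →₀ R} {ξ : Fin n → ℝ} {m : ℝ}

theorem toReal_add_mem_polyhedron {α : Fin n → ℕ} (hα : c α ≠ 0) {z : Fin n → ℝ} (hz : 0 ≤ z) :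
    toReal α + z ∈ polyhedron c :=
  subset_convexHull ℝ _ (Set.add_mem_add ⟨α, hα, rfl⟩ hz)

theorem toReal_mem_polyhedron {α : Fin n → ℕ} (hα : c α ≠ 0) : toReal α ∈ polyhedron c := by
  simpa using toReal_add_mem_polyhedron hα le_rfl

theorem convex_dotProduct_le (ξ : Fin n → ℝ) (m : ℝ) : Convex ℝ {q | ξ ⬝ᵥ q ≤ m} :=
  convex_halfSpace_le ⟨dotProduct_add ξ, fun r v => dotProduct_smul r ξ v⟩ m

theorem le_dotProduct_of_mem_polyhedron (hξ : 0 ≤ ξ) (h : ∀ α, c α ≠ 0 → m ≤ ξ ⬝ᵥ toReal α)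
    {q : Fin n → ℝ} (hq : q ∈ polyhedron c) : m ≤ ξ ⬝ᵥ q := by
  refine convexHull_min (t := {q | m ≤ ξ ⬝ᵥ q}) ?_
    (convex_halfSpace_ge ⟨dotProduct_add ξ, fun r v => dotProduct_smul r ξ v⟩ m) hq
  rintro _ ⟨_, ⟨α, hα, rfl⟩, z, hz, rfl⟩
  have h1 : 0 ≤ ξ ⬝ᵥ z := dotProduct_nonneg_of_nonneg hξ hz
  have h2 : m ≤ ξ ⬝ᵥ toReal α := h α hα
  change m ≤ ξ ⬝ᵥ (toReal α + z)
  rw [dotProduct_add]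
  linarith

theorem exists_dotProduct_le_of_mem_polyhedron (hξ : 0 ≤ ξ) {q : Fin n → ℝ}
    (hq : q ∈ polyhedron c) : ∃ α, c α ≠ 0 ∧ ξ ⬝ᵥ toReal α ≤ ξ ⬝ᵥ q := by
  by_contra! hlt
  refine lt_irrefl (ξ ⬝ᵥ q) (convexHull_min (t := {q' | ξ ⬝ᵥ q < ξ ⬝ᵥ q'}) ?_
    (convex_halfSpace_gt ⟨dotProduct_add ξ, fun r v => dotProduct_smul r ξ v⟩ _) hq)
  rintro _ ⟨_, ⟨α, hα, rfl⟩, z, hz, rfl⟩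
  have h1 : 0 ≤ ξ ⬝ᵥ z := dotProduct_nonneg_of_nonneg hξ hz
  have h2 := hlt α hα
  change ξ ⬝ᵥ q < ξ ⬝ᵥ (toReal α + z)
  rw [dotProduct_add]
  linarith

theorem convex_face (c : (Fin n → ℕ) →₀ R) (ξ : Fin n → ℝ) :
    Convex ℝ (face (polyhedron c) ξ) := by
  have : face (polyhedron c) ξ =
      polyhedron c ∩ ⋂ q ∈ polyhedron c, {p | ξ ⬝ᵥ p ≤ ξ ⬝ᵥ q} := by
    ext p; simp [face]
  rw [this]
  exact (convex_convexHull ℝ _).inter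
    (convex_iInter fun q => convex_iInter fun _ => convex_dotProduct_le ξ _)

/-- For positive `ξ`, the points of the polyhedron of minimal weight are convex combinations of
exponents of minimal weight. -/
theorem mem_convexHull_of_dotProduct_le (hξ : ∀ i, 0 < ξ i)
    (h : ∀ α, c α ≠ 0 → m ≤ ξ ⬝ᵥ toReal α) {q : Fin n → ℝ} (hq : q ∈ polyhedron c)
    (hqm : ξ ⬝ᵥ q ≤ m) :
    q ∈ convexHull ℝ (toReal '' {α | c α ≠ 0 ∧ ξ ⬝ᵥ toReal α = m}) := by
  set C := convexHull ℝ (toReal '' {α | c α ≠ 0 ∧ ξ ⬝ᵥ toReal α = m}) with hC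
  suffices hsub : polyhedron c ⊆ {q | m ≤ ξ ⬝ᵥ q ∧ (ξ ⬝ᵥ q ≤ m → q ∈ C)} from (hsub hq).2 hqm
  refine convexHull_min ?_ ?_
  · rintro _ ⟨_, ⟨α, hα, rfl⟩, z, hz, rfl⟩
    have hz' : 0 ≤ z := hz
    have h1 : 0 ≤ ξ ⬝ᵥ z := dotProduct_nonneg_of_nonneg (fun i => (hξ i).le) hz
    have h2 : m ≤ ξ ⬝ᵥ toReal α := h α hα
    change m ≤ ξ ⬝ᵥ (toReal α + z) ∧ (ξ ⬝ᵥ (toReal α + z) ≤ m → toReal α + z ∈ C)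
    rw [dotProduct_add]
    refine ⟨by linarith, fun h3 => ?_⟩
    have hz0 : z = 0 := by
      have h4 : ∑ i, ξ i * z i = 0 := by
        change ξ ⬝ᵥ z = 0
        linarith
      ext i
      have := (Finset.sum_eq_zero_iff_of_nonneg
        (fun i _ => mul_nonneg (hξ i).le (hz' i))).mp h4 i (Finset.mem_univ i)
      exact (mul_eq_zero.mp this).resolve_left (hξ i).ne'
    rw [hz0, add_zero]
    exact subset_convexHull ℝ _ ⟨α, ⟨hα, by linarith⟩, rfl⟩
  · rintro u ⟨hu, huC⟩ v ⟨hv, hvC⟩ r s hr hs hrs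
    have e : ξ ⬝ᵥ (r • u + s • v) = r * ξ ⬝ᵥ u + s * ξ ⬝ᵥ v := by
      simp [dotProduct_add, dotProduct_smul]
    have hru := mul_le_mul_of_nonneg_left hu hr
    have hsv := mul_le_mul_of_nonneg_left hv hs
    have hm : m = r * m + s * m := by rw [← add_mul, hrs, one_mul]
    refine ⟨by rw [e]; linarith, fun hle => ?_⟩
    rw [e] at hle
    rcases hr.eq_or_lt with h0 | hr0
    · obtain rfl : s = 1 := by linarith
      simpa [← h0] using hvC (by rw [← h0] at hle; linarith)
    rcases hs.eq_or_lt with h0 | hs0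
    · obtain rfl : r = 1 := by linarith
      simpa [← h0] using huC (by rw [← h0] at hle; linarith)
    have hum : ξ ⬝ᵥ u ≤ m := le_of_mul_le_mul_left (by linarith) hr0
    have hvm : ξ ⬝ᵥ v ≤ m := le_of_mul_le_mul_left (by linarith) hs0
    exact convex_convexHull ℝ _ (huC hum) (hvC hvm) hr hs hrs

theorem toReal_mem_face (hξ : 0 ≤ ξ) {a : Fin n → ℕ}
    (hmin : ∀ α, c α ≠ 0 → ξ ⬝ᵥ toReal a ≤ ξ ⬝ᵥ toReal α) {s : Fin n → ℕ} (hs : c s ≠ 0)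
    (hsa : ξ ⬝ᵥ toReal s = ξ ⬝ᵥ toReal a) : toReal s ∈ face (polyhedron c) ξ :=
  ⟨toReal_mem_polyhedron hs, fun _ hq => hsa ▸ le_dotProduct_of_mem_polyhedron hξ hmin hq⟩

theorem face_eq_convexHull (hξ : ∀ i, 0 < ξ i) {a : Fin n → ℕ} (ha : c a ≠ 0)
    (hmin : ∀ α, c α ≠ 0 → ξ ⬝ᵥ toReal a ≤ ξ ⬝ᵥ toReal α) :
    face (polyhedron c) ξ =
      convexHull ℝ (toReal '' {α | c α ≠ 0 ∧ ξ ⬝ᵥ toReal α = ξ ⬝ᵥ toReal a}) := by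
  refine Set.Subset.antisymm
    (fun q hq => mem_convexHull_of_dotProduct_le hξ hmin hq.1 (hq.2 _ (toReal_mem_polyhedron ha)))
    (convexHull_min ?_ (convex_face c ξ))
  rintro _ ⟨α, ⟨hα, hαa⟩, rfl⟩
  exact toReal_mem_face (fun i => (hξ i).le) hmin hα hαa

theorem isCompact_face (hξ : ∀ i, 0 < ξ i) {a : Fin n → ℕ} (ha : c a ≠ 0)
    (hmin : ∀ α, c α ≠ 0 → ξ ⬝ᵥ toReal a ≤ ξ ⬝ᵥ toReal α) :
    IsCompact (face (polyhedron c) ξ) := by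
  rw [face_eq_convexHull hξ ha hmin]
  refine Set.Finite.isCompact_convexHull ℝ (Set.Finite.image _ (c.support.finite_toSet.subset ?_))
  exact fun α hα => Finsupp.mem_support_iff.mpr hα.1

/-- A compact face is defined by a strictly positive covector: it contains no ray. -/
theorem pos_of_isCompact_face (hξ : 0 ≤ ξ) {a : Fin n → ℕ} (ha : c a ≠ 0)
    (hmin : ∀ α, c α ≠ 0 → ξ ⬝ᵥ toReal a ≤ ξ ⬝ᵥ toReal α)
    (hcomp : IsCompact (face (polyhedron c) ξ)) (i : Fin n) : 0 < ξ i := by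
  refine lt_of_le_of_ne (hξ i) fun h0 => ?_
  obtain ⟨B, hB⟩ := hcomp.bddAbove_image (f := fun p => p i) (continuous_apply i).continuousOn
  have hray : toReal a + Pi.single i (|B| + 1) ∈ face (polyhedron c) ξ := by
    refine ⟨toReal_add_mem_polyhedron ha (Pi.single_nonneg.mpr (by positivity)), fun q hq => ?_⟩
    rw [dotProduct_add, dotProduct_single, ← h0, zero_mul, add_zero]
    exact le_dotProduct_of_mem_polyhedron hξ hmin hq
  have h1 := hB ⟨_, hray, rfl⟩
  simp only [Pi.add_apply, Pi.single_eq_same] at h1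
  have h2 : 0 ≤ toReal a i := Nat.cast_nonneg _
  linarith [le_abs_self B]

theorem dim_eq_zero_of_subset_singleton {F : Set (Fin n → ℝ)} {p : Fin n → ℝ} (h : F ⊆ {p}) :
    dim F = 0 := by
  rw [dim, vectorSpan_of_subsingleton ℝ (Set.subsingleton_of_subset_singleton h), finrank_bot]

/-- A compact one-dimensional face contains two exponents `a`, `b` such that all exponents on the
face lie on the segment `[a, b]`. -/
theorem exists_endpoints_of_dim_eq_one {E : Set (Fin n → ℝ)} (hface : IsFace (polyhedron c) E)
    (hcomp : IsCompact E) (hdim : dim E = 1) :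
    ∃ (ξ : Fin n → ℝ) (a b : Fin n → ℕ), (∀ i, 0 < ξ i) ∧ E = face (polyhedron c) ξ ∧
      c a ≠ 0 ∧ c b ≠ 0 ∧ a ≠ b ∧ (∀ α, c α ≠ 0 → ξ ⬝ᵥ toReal a ≤ ξ ⬝ᵥ toReal α) ∧
      ξ ⬝ᵥ toReal b = ξ ⬝ᵥ toReal a ∧
      ∀ s, c s ≠ 0 → ξ ⬝ᵥ toReal s = ξ ⬝ᵥ toReal a →
        ∃ t : ℝ, 0 ≤ t ∧ t ≤ 1 ∧ toReal s = toReal a + t • (toReal b - toReal a) := by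
  classical
  obtain ⟨ξ, hξ, rfl⟩ := hface
  obtain ⟨p, hp⟩ : (face (polyhedron c) ξ).Nonempty := by
    rw [Set.nonempty_iff_ne_empty]
    intro h
    rw [h, dim_eq_zero_of_subset_singleton (Set.empty_subset {0})] at hdim
    exact zero_ne_one hdim
  obtain ⟨α₀, hα₀, hle⟩ := exists_dotProduct_le_of_mem_polyhedron hξ hp.1
  have hmin : ∀ α, c α ≠ 0 → ξ ⬝ᵥ toReal α₀ ≤ ξ ⬝ᵥ toReal α := fun α hα =>
    hle.trans (hp.2 _ (toReal_mem_polyhedron hα))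
  have hpos := pos_of_isCompact_face hξ hα₀ hmin hcomp
  have hhull := face_eq_convexHull hpos hα₀ hmin
  have hcol : Collinear ℝ (face (polyhedron c) ξ) :=
    collinear_iff_finrank_le_one.mpr hdim.le
  obtain ⟨v, hv⟩ := (collinear_iff_of_mem (toReal_mem_face hξ hmin hα₀ rfl)).mp hcol
  have hv0 : v ≠ 0 := by
    rintro rfl
    have h0 : face (polyhedron c) ξ ⊆ {toReal α₀} := by
      intro q hq
      obtain ⟨r, hr⟩ := hv q hq
      simpa using hr
    rw [dim_eq_zero_of_subset_singleton h0] at hdim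
    exact zero_ne_one hdim
  obtain ⟨i₀, hi₀⟩ := Function.ne_iff.mp hv0
  rw [Pi.zero_apply] at hi₀
  set S := c.support.filter fun s => ξ ⬝ᵥ toReal s = ξ ⬝ᵥ toReal α₀ with hS
  have hmemS : ∀ s, s ∈ S ↔ c s ≠ 0 ∧ ξ ⬝ᵥ toReal s = ξ ⬝ᵥ toReal α₀ := by simp [hS]
  have hSne : S.Nonempty := ⟨α₀, (hmemS _).mpr ⟨hα₀, rfl⟩⟩
  have hline : ∀ s ∈ S, ∃ r : ℝ, toReal s = r • v + toReal α₀ := fun s hs =>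
    hv _ (toReal_mem_face hξ hmin ((hmemS s).mp hs).1 ((hmemS s).mp hs).2)
  choose! r hr using hline
  obtain ⟨a, haS, hamin⟩ := Finset.exists_min_image S (fun s => s i₀) hSne
  obtain ⟨b, hbS, hbmax⟩ := Finset.exists_max_image S (fun s => s i₀) hSne
  -- The `i₀`-th coordinate is injective on the line.
  have hcoord : ∀ s ∈ S, ∀ s' ∈ S,
      toReal s i₀ - toReal s' i₀ = (r s - r s') * v i₀ := by
    intro s hs s' hs'
    rw [hr s hs, hr s' hs']
    simp
    ring
  have hab : a i₀ < b i₀ := by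
    by_contra! hba
    have hconst : ∀ s ∈ S, s = α₀ := by
      intro s hs
      have h1 : s i₀ = α₀ i₀ := by
        have := hamin s hs
        have := hbmax s hs
        have := hamin α₀ ((hmemS _).mpr ⟨hα₀, rfl⟩)
        have := hbmax α₀ ((hmemS _).mpr ⟨hα₀, rfl⟩)
        omega
      have h2 := congrFun (hr s hs) i₀
      simp only [Pi.add_apply, Pi.smul_apply, smul_eq_mul, toReal, h1, right_eq_add,
        mul_eq_zero, hi₀, or_false] at h2
      apply toReal_injective
      rw [hr s hs, h2, zero_smul, zero_add]
    have h0 : face (polyhedron c) ξ ⊆ {toReal α₀} := by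
      rw [hhull]
      refine convexHull_min ?_ (convex_singleton _)
      rintro _ ⟨s, hs, rfl⟩
      rw [hconst s ((hmemS s).mpr hs)]
      rfl
    rw [dim_eq_zero_of_subset_singleton h0] at hdim
    exact zero_ne_one hdim
  obtain ⟨ha, haα⟩ := (hmemS a).mp haS
  obtain ⟨hb, hbα⟩ := (hmemS b).mp hbS
  have hab' : toReal a i₀ < toReal b i₀ := by simpa [toReal] using hab
  refine ⟨ξ, a, b, hpos, rfl, ha, hb, fun h => by simp [h] at hab, ?_, by rw [hbα, haα], ?_⟩
  · rw [haα]
    exact hmin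
  · intro s hs hsa
    have hsS : s ∈ S := (hmemS s).mpr ⟨hs, hsa.trans haα⟩
    have h1 : toReal a i₀ ≤ toReal s i₀ := by simpa [toReal] using hamin s hsS
    have h2 : toReal s i₀ ≤ toReal b i₀ := by simpa [toReal] using hbmax s hsS
    have hd : 0 < toReal b i₀ - toReal a i₀ := by linarith
    refine ⟨(toReal s i₀ - toReal a i₀) / (toReal b i₀ - toReal a i₀),
      div_nonneg (by linarith) hd.le, (div_le_one hd).mpr (by linarith), ?_⟩
    have hrab : r b - r a ≠ 0 := by
      intro h
      rw [hcoord b hbS a haS, h, zero_mul] at hd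
      exact lt_irrefl _ hd
    rw [hcoord s hsS a haS, hcoord b hbS a haS, mul_div_mul_right _ _ hi₀, hr b hbS, hr a haS,
      hr s hsS, add_sub_add_right_eq_sub, ← sub_smul, smul_smul, div_mul_cancel₀ _ hrab]
    module

theorem two_le_dim {F : Set (Fin n → ℝ)} {p q r : Fin n → ℝ} (hp : p ∈ F) (hq : q ∈ F)
    (hr : r ∈ F) (h : LinearIndependent ℝ ![q - p, r - p]) : 2 ≤ dim F := by
  have h1 := finrank_span_eq_card h
  rw [Fintype.card_fin] at h1
  refine h1.ge.trans (Submodule.finrank_mono (Submodule.span_le.mpr ?_))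
  rintro _ ⟨i, rfl⟩
  fin_cases i
  · exact vsub_mem_vectorSpan ℝ hq hp
  · exact vsub_mem_vectorSpan ℝ hr hp

/-- If the edge is loose, every nonnegative covector constant on the edge attains its minimum
over the polyhedron there. Otherwise, moving the covector of the edge in the direction of a
covector `η` violating this, the first one to reach a further exponent defines a compact face of
dimension at least two containing the edge. -/
theorem dotProduct_le_of_loose {a b : Fin n → ℕ} (hξ : ∀ i, 0 < ξ i) (ha : c a ≠ 0) (hb : c b ≠ 0)
    (hab : a ≠ b) (hmin : ∀ α, c α ≠ 0 → ξ ⬝ᵥ toReal a ≤ ξ ⬝ᵥ toReal α)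
    (hba : ξ ⬝ᵥ toReal b = ξ ⬝ᵥ toReal a)
    (hedge : ∀ s, c s ≠ 0 → ξ ⬝ᵥ toReal s = ξ ⬝ᵥ toReal a →
      ∃ t : ℝ, 0 ≤ t ∧ t ≤ 1 ∧ toReal s = toReal a + t • (toReal b - toReal a))
    (hloose : ¬ ∃ F, IsFace (polyhedron c) F ∧ IsCompact F ∧ 2 ≤ dim F ∧
      face (polyhedron c) ξ ⊆ F)
    {η : Fin n → ℝ} (hη : 0 ≤ η) (hηd : η ⬝ᵥ (toReal b - toReal a) = 0)
    {s : Fin n → ℕ} (hs : c s ≠ 0) : η ⬝ᵥ toReal a ≤ η ⬝ᵥ toReal s := by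
  classical
  by_contra! hsa
  obtain ⟨s₁, hs₁, hfirst⟩ := Finset.exists_min_image
    (c.support.filter fun s => η ⬝ᵥ toReal s < η ⬝ᵥ toReal a)
    (fun s => (ξ ⬝ᵥ toReal s - ξ ⬝ᵥ toReal a) / (η ⬝ᵥ toReal a - η ⬝ᵥ toReal s))
    ⟨s, by simp [hs, hsa]⟩
  obtain ⟨hs₁c, hs₁η⟩ := Finset.mem_filter.mp hs₁
  rw [Finsupp.mem_support_iff] at hs₁c
  set l := (ξ ⬝ᵥ toReal s₁ - ξ ⬝ᵥ toReal a) / (η ⬝ᵥ toReal a - η ⬝ᵥ toReal s₁) with hl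
  have hden : 0 < η ⬝ᵥ toReal a - η ⬝ᵥ toReal s₁ := by linarith
  have hl0 : 0 ≤ l := div_nonneg (by linarith [hmin s₁ hs₁c]) hden.le
  set ζ := ξ + l • η with hζ
  have hζdot : ∀ u, ζ ⬝ᵥ u = ξ ⬝ᵥ u + l * η ⬝ᵥ u := fun u => by
    simp [hζ, add_dotProduct, smul_dotProduct]
  have hζpos : ∀ i, 0 < ζ i := fun i => add_pos_of_pos_of_nonneg (hξ i) (mul_nonneg hl0 (hη i))
  have hηb : η ⬝ᵥ toReal b = η ⬝ᵥ toReal a := by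
    rw [dotProduct_sub] at hηd
    linarith
  have hζmin : ∀ α, c α ≠ 0 → ζ ⬝ᵥ toReal a ≤ ζ ⬝ᵥ toReal α := by
    intro α hα
    rw [hζdot, hζdot]
    rcases le_or_gt (η ⬝ᵥ toReal a) (η ⬝ᵥ toReal α) with h | h
    · nlinarith [hmin α hα]
    · have h1 := hfirst α (by simp [hα, h])
      rw [le_div_iff₀ (by linarith)] at h1
      linarith
  have hs₁ζ : ζ ⬝ᵥ toReal s₁ = ζ ⬝ᵥ toReal a := by
    have : l * (η ⬝ᵥ toReal a - η ⬝ᵥ toReal s₁) = ξ ⬝ᵥ toReal s₁ - ξ ⬝ᵥ toReal a :=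
      div_mul_cancel₀ _ hden.ne'
    rw [hζdot, hζdot]
    linarith
  have hζ0 : 0 ≤ ζ := fun i => (hζpos i).le
  refine hloose ⟨face (polyhedron c) ζ, ⟨ζ, hζ0, rfl⟩, isCompact_face hζpos ha hζmin, ?_, ?_⟩
  · refine two_le_dim (toReal_mem_face hζ0 hζmin ha rfl)
      (toReal_mem_face hζ0 hζmin hb (by rw [hζdot, hζdot, hba, hηb]))
      (toReal_mem_face hζ0 hζmin hs₁c hs₁ζ) ?_
    rw [LinearIndependent.pair_iff]
    intro u v huv
    have h1 := congrArg (η ⬝ᵥ ·) huv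
    simp only [dotProduct_add, dotProduct_smul, hηd, dotProduct_sub η (toReal s₁), mul_zero,
      zero_add, dotProduct_zero, smul_eq_mul] at h1
    have hv : v = 0 := (mul_eq_zero.mp h1).resolve_right (by linarith)
    rw [hv, zero_smul, add_zero] at huv
    exact ⟨(smul_eq_zero.mp huv).resolve_right
      (sub_ne_zero.mpr fun h => hab (toReal_injective h).symm), hv⟩
  · rw [face_eq_convexHull hξ ha hmin]
    refine convexHull_min ?_ (convex_face c ζ)
    rintro _ ⟨α, ⟨hα, hαa⟩, rfl⟩
    obtain ⟨t, -, -, ht⟩ := hedge α hα hαa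
    refine toReal_mem_face hζ0 hζmin hα ?_
    rw [hζdot, hζdot, hαa, ht, dotProduct_add, dotProduct_smul, hηd, smul_zero, add_zero]

/-- Farkas' lemma for one unknown: the inequalities `t * d i ≤ u i` are solvable if every
nonnegative combination of them that eliminates `t` is valid. Combinations of two suffice. -/
theorem exists_smul_le {d u : Fin n → ℝ} (hd : ∃ i, 0 < d i)
    (h : ∀ η : Fin n → ℝ, 0 ≤ η → η ⬝ᵥ d = 0 → 0 ≤ η ⬝ᵥ u) : ∃ t : ℝ, t • d ≤ u := by
  classical
  obtain ⟨j, hj⟩ := hd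
  obtain ⟨i, hi, hmin⟩ := Finset.exists_min_image (Finset.univ.filter fun i => 0 < d i)
    (fun i => u i / d i) ⟨j, by simpa using hj⟩
  have hi0 : 0 < d i := (Finset.mem_filter.mp hi).2
  refine ⟨u i / d i, fun k => ?_⟩
  rw [Pi.smul_apply, smul_eq_mul]
  rcases lt_trichotomy (d k) 0 with hk | hk | hk
  · have := h (Pi.single i (-d k) + Pi.single k (d i))
      (add_nonneg (Pi.single_nonneg.mpr (by linarith)) (Pi.single_nonneg.mpr hi0.le))
      (by simp [add_dotProduct]; ring)
    simp only [add_dotProduct, single_dotProduct] at this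
    rw [div_mul_eq_mul_div, div_le_iff₀ hi0]
    linarith
  · have := h (Pi.single k 1) (Pi.single_nonneg.mpr zero_le_one) (by simp [hk])
    simpa [hk] using this
  · have := hmin k (by simpa using hk)
    rwa [le_div_iff₀ hk] at this

/-- If the polyhedron lies in the cone of the edge `[a, b]` and the edge has no common monomial
factor, then the cone meets the orthant only above the segment, and `a` and `b` are the only
vertices. -/
theorem inf_ne_zero_of_three_vertices {a b : Fin n → ℕ} (ha : c a ≠ 0) (hb : c b ≠ 0)
    (hcone : ∀ s, c s ≠ 0 → ∃ t : ℝ, toReal a + t • (toReal b - toReal a) ≤ toReal s)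
    (hvert : 3 ≤ (vertices (polyhedron c)).encard) : a ⊓ b ≠ 0 := by
  intro hγ
  have hnot : ¬ vertices (polyhedron c) ⊆ {toReal a, toReal b} := fun hsub => by
    have := (hvert.trans (Set.encard_le_encard hsub)).trans (Set.encard_insert_le _ _)
    rw [Set.encard_singleton] at this
    exact absurd this (by norm_num)
  obtain ⟨v, ⟨η, hη, hface⟩, hv⟩ := Set.not_subset.mp hnot
  simp only [Set.mem_insert_iff, Set.mem_singleton_iff, not_or] at hv
  obtain ⟨hva, hvb⟩ := hv
  have hvmem : v ∈ face (polyhedron c) η := hface ▸ Set.mem_singleton v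
  have huniq : ∀ q ∈ polyhedron c, η ⬝ᵥ q ≤ η ⬝ᵥ v → q = v := fun q hq hle => by
    have : q ∈ face (polyhedron c) η := ⟨hq, fun q' hq' => hle.trans (hvmem.2 q' hq')⟩
    rwa [← hface] at this
  obtain ⟨s, hs, hsv⟩ := exists_dotProduct_le_of_mem_polyhedron hη hvmem.1
  obtain ⟨t, ht⟩ := hcone s hs
  -- Each coordinate vanishes at `a` or at `b`, so that `t` may be moved into `[0, 1]`.
  obtain ⟨t', h0, h1, ht'⟩ : ∃ t' : ℝ, 0 ≤ t' ∧ t' ≤ 1 ∧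
      toReal a + t' • (toReal b - toReal a) ≤ toReal s := by
    have hzero : ∀ i, toReal a i = 0 ∨ toReal b i = 0 := fun i => by
      have := congrFun hγ i
      simp only [Pi.inf_apply, Pi.zero_apply, toReal, Nat.cast_eq_zero] at this ⊢
      omega
    have hnn : ∀ (α : Fin n → ℕ) i, 0 ≤ toReal α i := fun α i => Nat.cast_nonneg _
    refine ⟨max 0 (min t 1), le_max_left _ _, max_le zero_le_one (min_le_right _ _), fun i => ?_⟩
    have hti := ht i
    simp only [Pi.add_apply, Pi.smul_apply, Pi.sub_apply, smul_eq_mul] at hti ⊢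
    have ha0 := hnn a i
    have hb0 := hnn b i
    have hs0 := hnn s i
    rcases le_total t 0 with h | h
    · rw [min_eq_left (by linarith), max_eq_left h]
      rcases hzero i with h' | h' <;> rw [h'] at hti ⊢ <;> nlinarith
    · rcases le_total t 1 with h1 | h1
      · rwa [min_eq_left h1, max_eq_right h]
      · rw [min_eq_right h1, max_eq_right zero_le_one]
        rcases hzero i with h' | h' <;> rw [h'] at hti ⊢ <;> nlinarith
  have hpe : toReal a + t' • (toReal b - toReal a) = (1 - t') • toReal a + t' • toReal b := by
    module
  have hp : toReal a + t' • (toReal b - toReal a) = v := by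
    refine huniq _ ?_ ((dotProduct_le_dotProduct_of_nonneg_left ht' hη).trans hsv)
    rw [hpe]
    exact convex_convexHull ℝ _ (toReal_mem_polyhedron ha) (toReal_mem_polyhedron hb)
      (by linarith) h0 (by ring)
  have hηa := hvmem.2 _ (toReal_mem_polyhedron ha)
  have hηb := hvmem.2 _ (toReal_mem_polyhedron hb)
  have hηv : η ⬝ᵥ v = (1 - t') * η ⬝ᵥ toReal a + t' * η ⬝ᵥ toReal b := by
    rw [← hp, hpe]
    simp [dotProduct_add, dotProduct_smul]
  rcases h1.eq_or_lt with h | h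
  · refine hvb ?_
    rw [← hp, h]
    module
  · refine hva (huniq _ (toReal_mem_polyhedron ha) ?_).symm
    have : (1 - t') * η ⬝ᵥ toReal a ≤ (1 - t') * η ⬝ᵥ v := by
      nlinarith [mul_le_mul_of_nonneg_left hηb h0]
    exact le_of_mul_le_mul_left this (by linarith)

end geometry

end NewtonPoly

/-! ### The factorization of `f` -/

theorem corollary1p3 {R : Type*} [CommRing R] [IsRegularLocalRing R] {n : ℕ} (x : Fin n → R)
    (hx : NewtonPoly.IsRegularSystemOfParameters x) (f : R) (Δ : Set (Fin n → ℝ))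
    (hΔ : NewtonPoly.IsNewtonPolyhedron x f Δ)
    (hloose : ∃ E, NewtonPoly.IsLooseEdge Δ E)
    (hvert : 3 ≤ (NewtonPoly.vertices Δ).encard) :
    ¬ Irreducible
      (algebraMap R (AdicCompletion (IsLocalRing.maximalIdeal R) R) f) := by
  obtain ⟨-, c, ⟨hunit, rfl⟩, rfl⟩ := hΔ
  obtain ⟨E, hface, hcomp, hdim, hmax⟩ := hloose
  obtain ⟨ξ, a, b, hξ, rfl, ha, hb, hab, hmin, hba, hedge⟩ :=
    NewtonPoly.exists_endpoints_of_dim_eq_one hface hcomp hdim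
  have hξd : ξ ⬝ᵥ (NewtonPoly.toReal b - NewtonPoly.toReal a) = 0 := by
    rw [dotProduct_sub, hba, sub_self]
  have hcone : ∀ s, c s ≠ 0 → ∃ t : ℝ, NewtonPoly.toReal a +
      t • (NewtonPoly.toReal b - NewtonPoly.toReal a) ≤ NewtonPoly.toReal s := by
    intro s hs
    obtain ⟨i, hi⟩ := NewtonPoly.exists_lt_of_dotProduct_eq hξ hab hξd
    obtain ⟨t, ht⟩ := NewtonPoly.exists_smul_le
      (d := NewtonPoly.toReal b - NewtonPoly.toReal a)
      (u := NewtonPoly.toReal s - NewtonPoly.toReal a)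
      ⟨i, by simpa [NewtonPoly.toReal] using hi⟩ (fun η hη hηd => by
        rw [dotProduct_sub, sub_nonneg]
        exact NewtonPoly.dotProduct_le_of_loose hξ ha hb hab hmin hba hedge hmax hη hηd hs)
    exact ⟨t, le_sub_iff_add_le'.mp ht⟩
  refine NewtonPoly.not_irreducible_of_exponents_mem_cone (x := x)
    (Ideal.IsPrime.ne_top inferInstance)
    (fun i => hx.1 ▸ Ideal.subset_span (Set.mem_range_self i))
    (Finsupp.mem_support_iff.mpr ha) (Finsupp.mem_support_iff.mpr hb)
    ((hunit a).resolve_right ha) ((hunit b).resolve_right hb) hab hξ hξd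
    (fun s hs => hcone s (Finsupp.mem_support_iff.mp hs))
    (fun s hs => hedge s (Finsupp.mem_support_iff.mp hs))
    (NewtonPoly.inf_ne_zero_of_three_vertices ha hb hcone hvert)
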